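/- Let $K_{q\times r}$ denote the complete multipartite graph with $q$ parts, each of size $r$. A $k$-cycle decomposition of a graph $K$ is a set $\mathcal D$ of subgraphs of $K$, each of which is a cycle of length $k$, whose edge sets partition $E(K)$. It is cyclic (under $H$) if $H$ is a cyclic group of bijections of $V(K)$ that leaves $\mathcal D$ invariant and acts sharply transitively on $V(K)$. Two $k$-cycle decompositions $\mathcal D,\mathcal D'$ of $K$ are orthogonal if every $B\in\mathcal D$ and every $B'\in\mathcal D'$ have at most one edge in common. Let $n\ge k$ be positive integers such that one of the following holds: (1) $k\in\{3,7,9\}$ and $n\equiv 0,3\pmod 4$; (2) $k=5$ and $n\equiv 3\pmod 4$; (3) $k\in\{4,8\}$ ($n$ arbitrary); (4) $k=6$ and $n$ is even. Then there exist two orthogonal cyclic $k$-cycle decompositions of $K_{(2n+1)\times k}$, and they can be taken to be cyclic under one and the same group $H$. -/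

import Mathlib

namespace CycleDecomp

open SimpleGraph

/-- A `Γ`-decomposition of `K`: a set `D` of subgraphs of `K`, each isomorphic to `Γ`, whose edge
sets partition the edge set of `K`. -/
structure IsDecomposition {V W : Type*} (Γ : SimpleGraph W) (K : SimpleGraph V)
    (D : Set K.Subgraph) : Prop where
  iso : ∀ B ∈ D, Nonempty (B.coe ≃g Γ)
  partition : ∀ e ∈ K.edgeSet, ∃! B : K.Subgraph, B ∈ D ∧ e ∈ B.edgeSet

/-- `B'` is the image of the subgraph `B` under the bijection `σ` of the vertex set: its vertices
are the `σ x` with `x` a vertex of `B`, and its edges the `{σ x, σ y}` with `{x, y}` an edge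
of `B`. -/
def IsImage {V : Type*} {K : SimpleGraph V} (σ : Equiv.Perm V) (B B' : K.Subgraph) : Prop :=
  B'.verts = σ '' B.verts ∧ ∀ x y : V, B'.Adj (σ x) (σ y) ↔ B.Adj x y

/-- The group `H` of bijections of the vertex set leaves `D` invariant, i.e. `H` is an automorphism
group of `D`. (`H` being closed under inverses, `σ D ⊆ D` for all `σ ∈ H` gives `σ D = D`.) -/
def IsAutomorphismGroup {V : Type*} {K : SimpleGraph V} (H : Subgroup (Equiv.Perm V))
    (D : Set K.Subgraph) : Prop :=
  ∀ σ ∈ H, ∀ B ∈ D, ∃ B' ∈ D, IsImage σ B B'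

/-- `H` acts sharply transitively on `V`. -/
def IsSharplyTransitive {V : Type*} (H : Subgroup (Equiv.Perm V)) : Prop :=
  ∀ x y : V, ∃! σ : Equiv.Perm V, σ ∈ H ∧ σ x = y

/-- `D` is a `k`-cycle decomposition of `K` that is regular under the group `H` of bijections
of the vertex set. -/
structure IsRegularCycleDecomposition {V : Type*} (k : ℕ) (K : SimpleGraph V)
    (H : Subgroup (Equiv.Perm V)) (D : Set K.Subgraph) : Prop where
  decomposition : IsDecomposition (cycleGraph k) K D
  automorphismGroup : IsAutomorphismGroup H D
  sharplyTransitive : IsSharplyTransitive H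

/-- Two decompositions are orthogonal if a member of the first and a member of the second always
have at most one edge in common. -/
def Orthogonal {V : Type*} {K : SimpleGraph V} (D D' : Set K.Subgraph) : Prop :=
  ∀ B ∈ D, ∀ B' ∈ D', (B.edgeSet ∩ B'.edgeSet).Subsingleton

end CycleDecomp

/-! Put N = k(2n+1) and identify the vertices with ℤ/N so that the parts are the residue classes mod
2n+1. Then u and w are adjacent exactly when their difference is not a multiple of 2n+1. Suppose n
base cycles of length k are such that their differences, taken in both directions, give each
non-multiple of 2n+1 exactly once. Then every edge lies in exactly one translate of a base cycle,
and the translates form a decomposition that is regular under the cyclic group ℤ/N.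

Negating the base cycles gives a second decomposition under the same translations. An edge shared by
a translate of a base cycle and a translate of a negated one must come from the same position of the
same base cycle. The two translation parameters then differ by the sum of the two vertices at that
position. So two common edges would force two equal consecutive sums, and it is enough that the k
consecutive sums in each base cycle be distinct (`orthogonal_translates_neg`).

`exists_orthogonal_of_base_cycles` turns this into a statement about integers: the nk absolute
differences must cover the non-multiples of 2n+1 up to N/2. Each integer cycle closes because its
signed differences add to zero. For even k, pairs of differences with gap 1 or 2 are combined so
that the gaps cancel. For k = 3, 7, 9 a zero-sum triple from a Rosa sequence (hence n ≡ 0, 3 mod 4)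
is used, together with cancelling pairs. For k = 5 there is a separate construction. -/

namespace CycleDecomp

open SimpleGraph

/-! ### Translates of base cycles in an abelian group, and orthogonality to the negatives. -/

section BaseCycles

variable {V G ι : Type*} [AddCommGroup G] {k : ℕ} [NeZero k]

/-- The group of translations of `V`, where `V` is identified with the group `G`. -/
def translationHom (φ : V ≃ G) : Multiplicative G →* Equiv.Perm V where
  toFun h := (φ.trans (Equiv.addRight h.toAdd)).trans φ.symm
  map_one' := by ext; simp
  map_mul' a b := by ext; simp [add_comm, add_left_comm]

lemma apply_translationHom (φ : V ≃ G) (h : Multiplicative G) (u : V) :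
    φ (translationHom φ h u) = φ u + h.toAdd := by
  simp [translationHom]

lemma isSharplyTransitive_range_translationHom (φ : V ≃ G) :
    IsSharplyTransitive (translationHom φ).range := by
  intro u w
  refine ⟨translationHom φ (Multiplicative.ofAdd (φ w - φ u)), ⟨⟨_, rfl⟩, ?_⟩, ?_⟩
  · apply φ.injective
    rw [apply_translationHom, toAdd_ofAdd, add_sub_cancel]
  · rintro _ ⟨⟨h, rfl⟩, huw⟩
    congr 1
    rw [← huw, apply_translationHom]
    simp

/-- The difference along the edge of the base cycle `y i` from position `j`, taken in the direction
given by the Boolean. -/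
def signedDiff (y : ι → Fin k → G) (p : (ι × Fin k) × Bool) : G :=
  if p.2 then y p.1.1 (p.1.2 + 1) - y p.1.1 p.1.2 else y p.1.1 p.1.2 - y p.1.1 (p.1.2 + 1)

/-- The translate by `g` of the base cycle `y i`, as a subgraph of `K`. -/
def translate (K : SimpleGraph V) (φ : V ≃ G) (y : ι → Fin k → G) (i : ι) (g : G) :
    K.Subgraph where
  verts := {u | ∃ j, φ u = y i j + g}
  Adj u w := K.Adj u w ∧ ∃ j, (φ u = y i j + g ∧ φ w = y i (j + 1) + g) ∨
    (φ w = y i j + g ∧ φ u = y i (j + 1) + g)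
  adj_sub h := h.1
  edge_vert := by
    rintro u w ⟨-, j, h | h⟩
    exacts [⟨j, h.1⟩, ⟨j + 1, h.2⟩]
  symm := ⟨by
    rintro u w ⟨h, j, h' | h'⟩
    exacts [⟨h.symm, j, Or.inr h'⟩, ⟨h.symm, j, Or.inl h'⟩]⟩

/-- The set of all translates of the base cycles `y i`. -/
def translates (K : SimpleGraph V) (φ : V ≃ G) (y : ι → Fin k → G) : Set K.Subgraph :=
  {B | ∃ i g, B = translate K φ y i g}

variable {K : SimpleGraph V} {φ : V ≃ G} {T : Set G} {y : ι → Fin k → G}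

lemma translate_adj_iff (hK : ∀ u w, K.Adj u w ↔ φ w - φ u ∈ T) (hT : ∀ p, signedDiff y p ∈ T)
    {i : ι} {g : G} {u w : V} :
    (translate K φ y i g).Adj u w ↔ ∃ j, (φ u = y i j + g ∧ φ w = y i (j + 1) + g) ∨
      (φ w = y i j + g ∧ φ u = y i (j + 1) + g) := by
  refine ⟨fun h => h.2, fun h => ⟨?_, h⟩⟩
  rw [hK]
  obtain ⟨j, ⟨h1, h2⟩ | ⟨h1, h2⟩⟩ := h
  · simpa [h1, h2, signedDiff] using hT ((i, j), true)
  · simpa [h1, h2, signedDiff] using hT ((i, j), false)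

lemma nonempty_translate_iso (hk : 2 ≤ k) (hK : ∀ u w, K.Adj u w ↔ φ w - φ u ∈ T)
    (hT : ∀ p, signedDiff y p ∈ T) (i : ι) (hy : Function.Injective (y i)) (g : G) :
    Nonempty ((translate K φ y i g).coe ≃g cycleGraph k) := by
  let f : Fin k → (translate K φ y i g).verts := fun j => ⟨φ.symm (y i j + g), j, by simp⟩
  have hf : Function.Bijective f := by
    constructor
    · intro a b hab
      have := φ.symm.injective (Subtype.ext_iff.1 hab)
      exact hy (add_right_cancel this)
    · rintro ⟨u, j, hj⟩
      refine ⟨j, Subtype.ext ?_⟩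
      simp [f, ← hj]
  refine ⟨RelIso.symm ⟨Equiv.ofBijective f hf, ?_⟩⟩
  intro a b
  simp only [Equiv.ofBijective_apply, Subgraph.coe_adj]
  rw [translate_adj_iff hK hT]
  simp only [f, Equiv.apply_symm_apply, add_left_inj, hy.eq_iff]
  obtain ⟨k, rfl⟩ := Nat.exists_eq_add_of_le' hk
  rw [cycleGraph_adj]
  constructor
  · rintro ⟨j, ⟨rfl, rfl⟩ | ⟨rfl, rfl⟩⟩ <;> simp
  · rintro (h | h)
    · exact ⟨b, Or.inr ⟨rfl, by rw [← h]; abel⟩⟩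
    · exact ⟨a, Or.inl ⟨rfl, by rw [← h]; abel⟩⟩

/-- The difference of the endpoints determines the base cycle, the position and the direction; the
position of one endpoint then determines the translation. -/
lemma existsUnique_translate (hK : ∀ u w, K.Adj u w ↔ φ w - φ u ∈ T)
    (hT : ∀ p, signedDiff y p ∈ T) (hinj : Function.Injective (signedDiff y))
    (hsurj : ∀ t ∈ T, ∃ p, signedDiff y p = t) {u w : V} (huw : K.Adj u w) :
    ∃! B : K.Subgraph, B ∈ translates K φ y ∧ B.Adj u w := by
  obtain ⟨⟨⟨i, j⟩, b⟩, hp⟩ := hsurj _ ((hK u w).1 huw)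
  refine ⟨translate K φ y i (if b then φ u - y i j else φ w - y i j), ⟨⟨i, _, rfl⟩, ?_⟩, ?_⟩
  · rw [translate_adj_iff hK hT]
    refine ⟨j, ?_⟩
    cases b
    · right
      simp only [signedDiff, Bool.false_eq_true, if_false] at hp ⊢
      refine ⟨by abel, ?_⟩
      rw [← sub_eq_zero] at hp ⊢
      rw [← hp]; abel
    · left
      simp only [signedDiff, if_true] at hp ⊢
      refine ⟨by abel, ?_⟩
      rw [← sub_eq_zero] at hp ⊢
      rw [← neg_eq_zero, ← hp]; abel
  · rintro _ ⟨⟨i', g, rfl⟩, hadj⟩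
    rw [translate_adj_iff hK hT] at hadj
    obtain ⟨j', ⟨h1, h2⟩ | ⟨h1, h2⟩⟩ := hadj
    · have : signedDiff y ((i', j'), true) = signedDiff y ((i, j), b) := by
        rw [hp, h1, h2]; simp [signedDiff]
      have := hinj this
      simp only [Prod.mk.injEq] at this
      obtain ⟨⟨rfl, rfl⟩, rfl⟩ := this
      simp [h1]
    · have : signedDiff y ((i', j'), false) = signedDiff y ((i, j), b) := by
        rw [hp, h1, h2]; simp [signedDiff]
      have := hinj this
      simp only [Prod.mk.injEq] at this
      obtain ⟨⟨rfl, rfl⟩, rfl⟩ := this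
      simp [h1]

lemma isImage_translate (hK : ∀ u w, K.Adj u w ↔ φ w - φ u ∈ T) (hT : ∀ p, signedDiff y p ∈ T)
    (h : Multiplicative G) (i : ι) (g : G) :
    IsImage (translationHom φ h) (translate K φ y i g) (translate K φ y i (g + h.toAdd)) := by
  constructor
  · ext u
    constructor
    · rintro ⟨j, hj⟩
      refine ⟨φ.symm (y i j + g), ⟨j, by simp⟩, φ.injective ?_⟩
      rw [apply_translationHom, hj]
      simp [add_assoc]
    · rintro ⟨w, ⟨j, hj⟩, rfl⟩
      exact ⟨j, by rw [apply_translationHom, hj, add_assoc]⟩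
  · intro u w
    rw [translate_adj_iff hK hT, translate_adj_iff hK hT]
    simp only [apply_translationHom, ← add_assoc, add_left_inj]

theorem isRegularCycleDecomposition_translates (hk : 2 ≤ k)
    (hK : ∀ u w, K.Adj u w ↔ φ w - φ u ∈ T)
    (hT : ∀ p, signedDiff y p ∈ T) (hinj : Function.Injective (signedDiff y))
    (hsurj : ∀ t ∈ T, ∃ p, signedDiff y p = t) (hy : ∀ i, Function.Injective (y i)) :
    IsRegularCycleDecomposition k K (translationHom φ).range (translates K φ y) where
  decomposition :=
    { iso := by
        rintro _ ⟨i, g, rfl⟩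
        exact nonempty_translate_iso hk hK hT i (hy i) g
      partition := by
        intro e
        induction e with
        | _ u w =>
          intro h
          exact existsUnique_translate hK hT hinj hsurj h }
  automorphismGroup := by
    rintro _ ⟨h, rfl⟩ _ ⟨i, g, rfl⟩
    exact ⟨_, ⟨i, _, rfl⟩, isImage_translate hK hT h i g⟩
  sharplyTransitive := isSharplyTransitive_range_translationHom φ

lemma exists_eq_of_mem_edgeSet_translate {i : ι} {g : G} {e : Sym2 V}
    (he : e ∈ (translate K φ y i g).edgeSet) :
    ∃ j, e = s(φ.symm (y i j + g), φ.symm (y i (j + 1) + g)) := by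
  induction e with
  | _ u w =>
    obtain ⟨-, j, ⟨h1, h2⟩ | ⟨h1, h2⟩⟩ := he
    · exact ⟨j, by simp [← h1, ← h2]⟩
    · exact ⟨j, by simp [← h1, ← h2, Sym2.eq_swap]⟩

/-- If the sums of consecutive vertices within each base cycle are distinct, then the translates of
the base cycles are orthogonal to those of their negatives. -/
theorem orthogonal_translates_neg (hinj : Function.Injective (signedDiff y))
    (hsum : ∀ i, Function.Injective fun j => y i j + y i (j + 1)) :
    Orthogonal (translates K φ y) (translates K φ (-y)) := by
  rintro _ ⟨i, g, rfl⟩ _ ⟨i', g', rfl⟩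
  have key : ∀ e ∈ (translate K φ y i g).edgeSet ∩ (translate K φ (-y) i' g').edgeSet,
      ∃ j, e = s(φ.symm (y i j + g), φ.symm (y i (j + 1) + g)) ∧
        y i j + y i (j + 1) = g' - g := by
    rintro e ⟨h1, h2⟩
    obtain ⟨j, rfl⟩ := exists_eq_of_mem_edgeSet_translate h1
    obtain ⟨j', h⟩ := exists_eq_of_mem_edgeSet_translate h2
    refine ⟨j, rfl, ?_⟩
    simp only [Pi.neg_apply, Sym2.eq_iff, EmbeddingLike.apply_eq_iff_eq] at h
    obtain ⟨ha, hb⟩ | ⟨ha, hb⟩ := h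
    -- If the two edges match without a swap, one difference arises in both directions, which
    -- injectivity of `signedDiff` forbids.
    · have : signedDiff y ((i, j), true) = signedDiff y ((i', j'), false) := by
        have := congrArg₂ (· - ·) hb ha
        simp only [add_sub_add_right_eq_sub] at this
        simp only [signedDiff, if_true, this]
        simp; abel
      simpa using hinj this
    -- If they match with a swap, the positions coincide and the vertex sum at that position is `g'
    -- - g`.
    · have : signedDiff y ((i, j), true) = signedDiff y ((i', j'), true) := by
        have := congrArg₂ (· - ·) hb ha
        simp only [add_sub_add_right_eq_sub] at this
        simp only [signedDiff, if_true, this]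
        abel
      have := hinj this
      simp only [Prod.mk.injEq] at this
      obtain ⟨⟨rfl, rfl⟩, -⟩ := this
      rw [← sub_eq_zero] at hb ⊢
      rw [← hb]; abel
  intro e he e' he'
  obtain ⟨j, rfl, hj⟩ := key e he
  obtain ⟨j', rfl, hj'⟩ := key e' he'
  have : j = j' := hsum i (hj.trans hj'.symm)
  rw [this]

end BaseCycles

/-! ### Reduction to base cycles of integers. -/

/-- A map onto (a superset of) a finite set as large as its domain is a bijection onto that set. -/
lemma injective_and_mem_of_card_eq {α β : Type*} [Fintype α] [DecidableEq β] (f : α → β)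
    (T : Finset β) (hcard : Fintype.card α = T.card) (hT : ∀ t ∈ T, ∃ a, f a = t) :
    Function.Injective f ∧ ∀ a, f a ∈ T := by
  have hsub : T ⊆ Finset.univ.image f := by
    intro t ht
    obtain ⟨a, rfl⟩ := hT t ht
    simp
  have hle : (Finset.univ.image f).card ≤ T.card := by
    rw [← hcard]
    exact Finset.card_image_le
  have heq := Finset.eq_of_subset_of_card_le hsub hle
  constructor
  · have : (Finset.univ.image f).card = (Finset.univ : Finset α).card := by
      rw [← heq, ← hcard, Finset.card_univ]
    intro a b hab
    exact Finset.injOn_of_card_image_eq this (by simp) (by simp) hab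
  · intro a
    rw [heq]
    simp

/-- The vertices of the complete equipartite graph as residues, the parts being the residue classes
modulo the number of parts. -/
def vertexEquiv (m k : ℕ) [NeZero (k * m)] : Fin m × Fin k ≃ ZMod (k * m) :=
  ((Equiv.prodComm _ _).trans finProdFinEquiv).trans
    { toFun := fun a => (a.val : ZMod (k * m))
      invFun := fun z => ⟨z.val, z.val_lt⟩
      left_inv := fun a => Fin.ext (ZMod.val_cast_of_lt a.isLt)
      right_inv := fun z => ZMod.natCast_zmod_val z }

lemma castHom_vertexEquiv (m k : ℕ) [NeZero (k * m)] (u : Fin m × Fin k) :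
    ZMod.castHom (Dvd.intro_left k rfl) (ZMod m) (vertexEquiv m k u) = (u.1.val : ZMod m) := by
  simp [vertexEquiv]

lemma completeEquipartiteGraph_adj_iff_castHom (m k : ℕ) [NeZero (k * m)] (u w : Fin m × Fin k) :
    (completeEquipartiteGraph m k).Adj u w ↔
      ZMod.castHom (Dvd.intro_left k rfl) (ZMod m) (vertexEquiv m k w - vertexEquiv m k u) ≠ 0 := by
  rw [completeEquipartiteGraph_adj, map_sub, castHom_vertexEquiv, castHom_vertexEquiv, sub_ne_zero,
    ne_eq, ne_eq, not_iff_not, ZMod.natCast_eq_natCast_iff', Nat.mod_eq_of_lt u.1.isLt,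
    Nat.mod_eq_of_lt w.1.isLt, Fin.ext_iff, eq_comm]

/-- Distinct integers in a window of length N stay distinct mod N. -/
lemma injective_intCast_of_lt {α : Type*} {N : ℕ} (f : α → ℤ) (hf : Function.Injective f)
    (hlt : ∃ lo : ℤ, ∀ a, lo ≤ f a ∧ f a < lo + N) : Function.Injective fun a => (f a : ZMod N) := by
  obtain ⟨lo, hlo⟩ := hlt
  intro a b hab
  apply hf
  have h : (N : ℤ) ∣ f b - f a := (ZMod.intCast_eq_intCast_iff_dvd_sub _ _ _).1 hab
  have h0 : f b - f a = 0 := by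
    apply Int.eq_zero_of_abs_lt_dvd h
    rw [abs_lt]
    have h1 := hlo a
    have h2 := hlo b
    omega
  omega

/-- The existence of two orthogonal `k`-cycle decompositions of the complete multipartite graph with
`2 * n + 1` parts of size `k` that are regular under one cyclic group. -/
def ExistsOrthogonalCyclic (n k : ℕ) : Prop :=
  ∃ (H : Subgroup (Equiv.Perm (Fin (2 * n + 1) × Fin k)))
    (D D' : Set (completeEquipartiteGraph (2 * n + 1) k).Subgraph),
    IsCyclic H ∧
    IsRegularCycleDecomposition k (completeEquipartiteGraph (2 * n + 1) k) H D ∧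
    IsRegularCycleDecomposition k (completeEquipartiteGraph (2 * n + 1) k) H D' ∧
    Orthogonal D D'

/-- Integral base cycles in which every admissible difference occurs up to sign, and whose vertices
and consecutive sums do not repeat, yield two orthogonal cyclic cycle decompositions. -/
theorem exists_orthogonal_of_base_cycles (n k : ℕ) (hk : 2 ≤ k) [NeZero k] (x : ℕ → Fin k → ℤ)
    (hinj : ∀ i < n, Function.Injective (x i))
    (hlt : ∀ i < n, ∃ lo : ℤ, ∀ a, lo ≤ x i a ∧ x i a < lo + (k * (2 * n + 1) : ℕ))
    (hsum : ∀ i < n, Function.Injective fun j => x i j + x i (j + 1))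
    (hsumlt : ∀ i < n, ∃ lo : ℤ, ∀ a, lo ≤ x i a + x i (a + 1) ∧
      x i a + x i (a + 1) < lo + (k * (2 * n + 1) : ℕ))
    (hcover : ∀ d : ℕ, 2 * d ≤ k * (2 * n + 1) → (∀ c, d ≠ c * (2 * n + 1)) →
      ∃ i < n, ∃ j, x i (j + 1) - x i j = d ∨ x i j - x i (j + 1) = d) :
    ExistsOrthogonalCyclic n k := by
  have hk0 : k ≠ 0 := NeZero.ne k
  have : NeZero (k * (2 * n + 1)) := ⟨by positivity⟩
  set N := k * (2 * n + 1) with hN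
  let φ := vertexEquiv (2 * n + 1) k
  let π := ZMod.castHom (Dvd.intro_left k rfl : 2 * n + 1 ∣ k * (2 * n + 1)) (ZMod (2 * n + 1))
  let T : Set (ZMod N) := {t | π t ≠ 0}
  let y : Fin n → Fin k → ZMod N := fun i j => (x i j : ZMod N)
  have hK : ∀ u w, (completeEquipartiteGraph (2 * n + 1) k).Adj u w ↔ φ w - φ u ∈ T :=
    completeEquipartiteGraph_adj_iff_castHom (2 * n + 1) k
  have hsurj : ∀ t ∈ T, ∃ p, signedDiff y p = t := by
    intro t ht
    -- The representative of least absolute value is at most N/2 in size, so covering up to sign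
    -- suffices.
    have hmem := t.valMinAbs_mem_Ioc
    rw [Set.mem_Ioc] at hmem
    have hmod : ∀ c, t.valMinAbs.natAbs ≠ c * (2 * n + 1) := by
      intro c h0
      apply ht
      have hdvd : ((2 * n + 1 : ℕ) : ℤ) ∣ t.valMinAbs := Int.natCast_dvd.2 ⟨c, by rw [h0, mul_comm]⟩
      rw [← t.coe_valMinAbs, map_intCast]
      exact (ZMod.intCast_zmod_eq_zero_iff_dvd _ _).2 hdvd
    obtain ⟨i, hi, j, hj⟩ := hcover t.valMinAbs.natAbs (by omega) hmod
    have hj' : x i (j + 1) - x i j = t.valMinAbs ∨ x i j - x i (j + 1) = t.valMinAbs := by omega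
    rcases hj' with h | h
    · refine ⟨((⟨i, hi⟩, j), true), ?_⟩
      rw [← t.coe_valMinAbs, ← h]
      simp [signedDiff, y]
    · refine ⟨((⟨i, hi⟩, j), false), ?_⟩
      rw [← t.coe_valMinAbs, ← h]
      simp [signedDiff, y]
  have hφT : ∀ u, φ u ∈ T ↔ u.1 ≠ 0 := by
    intro u
    change π (φ u) ≠ 0 ↔ _
    rw [castHom_vertexEquiv, ne_eq, ne_eq, not_iff_not, ZMod.natCast_eq_zero_iff, Fin.ext_iff]
    exact ⟨fun h => Nat.eq_zero_of_dvd_of_lt h u.1.isLt, fun h => by rw [h]; simp⟩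
  -- There are 2nk signed differences and 2nk admissible residues, so covering already implies that
  -- no difference is repeated or inadmissible.
  obtain ⟨hsd, hsdT⟩ := injective_and_mem_of_card_eq (signedDiff y)
    ((({0}ᶜ : Finset (Fin (2 * n + 1))) ×ˢ (Finset.univ : Finset (Fin k))).map φ.toEmbedding)
    (by simp [Finset.card_compl]; ring)
    (by
      intro t ht
      apply hsurj
      simp only [Finset.mem_map, Finset.mem_product] at ht
      obtain ⟨u, hu, rfl⟩ := ht
      exact (hφT u).2 (by simpa using hu.1))
  have hT : ∀ p, signedDiff y p ∈ T := by
    intro p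
    have := hsdT p
    simp only [Finset.mem_map, Finset.mem_product] at this
    obtain ⟨u, hu, h⟩ := this
    rw [← h]
    exact (hφT u).2 (by simpa using hu.1)
  have hyinj : ∀ i, Function.Injective (y i) := fun i =>
    injective_intCast_of_lt _ (hinj i i.isLt) (hlt i i.isLt)
  have hneg : ∀ p, signedDiff (-y) p = signedDiff y (p.1, !p.2) := by
    rintro ⟨⟨i, j⟩, b⟩
    cases b <;> simp [signedDiff] <;> abel
  refine ⟨(translationHom φ).range, translates _ φ y, translates _ φ (-y), ?_, ?_, ?_, ?_⟩
  · exact isCyclic_of_surjective _ (translationHom φ).rangeRestrict_surjective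
  · exact isRegularCycleDecomposition_translates hk hK hT hsd hsurj hyinj
  · refine isRegularCycleDecomposition_translates hk hK (fun p => hneg p ▸ hT _) ?_ ?_ ?_
    · intro p q hpq
      rw [hneg, hneg] at hpq
      have := hsd hpq
      simp only [Prod.mk.injEq, Bool.not_inj_iff] at this
      exact Prod.ext this.1 this.2
    · intro t ht
      obtain ⟨p, rfl⟩ := hsurj t ht
      exact ⟨(p.1, !p.2), by simp [hneg]⟩
    · exact fun i => neg_injective.comp (hyinj i)
  · apply orthogonal_translates_neg hsd
    intro i
    have := injective_intCast_of_lt _ (hsum i i.isLt) (hsumlt i i.isLt)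
    simpa [y] using this

/-! ### Rosa sequences and the triples they give. -/

lemma injective_of_forall_lt_ne {α β : Type*} [LinearOrder α] {f : α → β}
    (h : ∀ a b, a < b → f a ≠ f b) : Function.Injective f := by
  intro a b hab
  rcases lt_trichotomy a b with hlt | heq | hlt
  · exact absurd hab (h a b hlt)
  · exact heq
  · exact absurd hab.symm (h b a hlt)

/-- A set `{1, …, 2n + 1} \ {n + 1}` splits into pairs with differences `1, …, n` if `n ≡ 3 mod 4`
and `7 ≤ n` (a Rosa sequence). -/
lemma exists_rosa_of_mod_four_eq_three (s : ℕ) (hs : 1 ≤ s) : ∃ a : ℕ → ℕ,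
    (∀ r, 1 ≤ r → r ≤ 4 * s + 3 → 1 ≤ a r ∧ a r + r ≤ 8 * s + 7) ∧
    ∀ x, 1 ≤ x → x ≤ 8 * s + 7 → x ≠ 4 * s + 4 →
      ∃ r, 1 ≤ r ∧ r ≤ 4 * s + 3 ∧ (x = a r ∨ x = a r + r) := by
  -- Even r: nested pairs centred at 2s+2, filling 1, …, 4s+3 except the centre. Odd r: nested pairs
  -- with sum 12s+11 (large r) or 12s+9 (small r). The exceptional r = 4s+3, 2s+3, 1 use the centre
  -- 2s+2 and the places left over.
  let a : ℕ → ℕ := fun r =>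
    if r % 2 = 0 then 2 * s + 2 - r / 2
    else if r = 4 * s + 3 then 2 * s + 2
    else if r = 2 * s + 3 then 6 * s + 4
    else if r = 1 then 7 * s + 6
    else if 2 * s + 3 < r then (12 * s + 11 - r) / 2
    else (12 * s + 9 - r) / 2
  refine ⟨a, ?_, ?_⟩
  · intro r h1 h2
    simp only [a]
    split_ifs <;> omega
  · intro x h1 h2 h3
    by_cases x ≤ 2 * s + 1
    · refine ⟨2 * (2 * s + 2 - x), by omega, by omega, Or.inl ?_⟩
      simp only [a]
      split_ifs <;> omega
    by_cases x = 2 * s + 2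
    · refine ⟨4 * s + 3, by omega, by omega, Or.inl ?_⟩
      simp only [a]
      split_ifs <;> omega
    by_cases x ≤ 4 * s + 3
    · refine ⟨2 * (x - (2 * s + 2)), by omega, by omega, Or.inr ?_⟩
      simp only [a]
      split_ifs <;> omega
    by_cases x = 6 * s + 5
    · refine ⟨4 * s + 3, by omega, by omega, Or.inr ?_⟩
      simp only [a]
      split_ifs <;> omega
    by_cases x = 6 * s + 4
    · refine ⟨2 * s + 3, by omega, by omega, Or.inl ?_⟩
      simp only [a]
      split_ifs <;> omega
    by_cases x = 8 * s + 7
    · refine ⟨2 * s + 3, by omega, by omega, Or.inr ?_⟩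
      simp only [a]
      split_ifs <;> omega
    by_cases x = 7 * s + 6
    · refine ⟨1, by omega, by omega, Or.inl ?_⟩
      simp only [a]
      split_ifs <;> first | omega | contradiction
    by_cases x = 7 * s + 7
    · refine ⟨1, by omega, by omega, Or.inr ?_⟩
      simp only [a]
      split_ifs <;> first | omega | contradiction
    by_cases x ≤ 5 * s + 3
    · refine ⟨12 * s + 11 - 2 * x, by omega, by omega, Or.inl ?_⟩
      simp only [a]
      split_ifs <;> omega
    by_cases x ≤ 6 * s + 3
    · refine ⟨12 * s + 9 - 2 * x, by omega, by omega, Or.inl ?_⟩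
      simp only [a]
      split_ifs <;> omega
    by_cases x ≤ 7 * s + 5
    · refine ⟨2 * x - (12 * s + 9), by omega, by omega, Or.inr ?_⟩
      simp only [a]
      split_ifs <;> omega
    · refine ⟨2 * x - (12 * s + 11), by omega, by omega, Or.inr ?_⟩
      simp only [a]
      split_ifs <;> omega

/-- A set `{1, …, 2n + 1} \ {n + 1}` splits into pairs with differences `1, …, n` if `n ≡ 0 mod 4`
and `8 ≤ n` (a Rosa sequence). -/
lemma exists_rosa_of_mod_four_eq_zero (s : ℕ) (hs : 2 ≤ s) : ∃ a : ℕ → ℕ,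
    (∀ r, 1 ≤ r → r ≤ 4 * s → 1 ≤ a r ∧ a r + r ≤ 8 * s + 1) ∧
    ∀ x, 1 ≤ x → x ≤ 8 * s + 1 → x ≠ 4 * s + 1 →
      ∃ r, 1 ≤ r ∧ r ≤ 4 * s ∧ (x = a r ∨ x = a r + r) := by
  -- Even r < 4s: nested pairs centred at 2s. Odd r: nested pairs with sum 12s+1 or 12s-1. The
  -- exceptional r = 4s, 4s-1, 2s+1, 1 use the remaining places.
  let a : ℕ → ℕ := fun r =>
    if r = 4 * s then 4 * s
    else if r % 2 = 0 then 2 * s - r / 2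
    else if r = 4 * s - 1 then 2 * s
    else if r = 1 then 7 * s
    else if r = 2 * s + 1 then 6 * s
    else if 2 * s + 1 < r then (12 * s + 1 - r) / 2
    else (12 * s - 1 - r) / 2
  refine ⟨a, ?_, ?_⟩
  · intro r h1 h2
    simp only [a]
    split_ifs <;> omega
  · intro x h1 h2 h3
    by_cases x = 4 * s
    · refine ⟨4 * s, by omega, by omega, Or.inl ?_⟩
      simp only [a]
      split_ifs <;> omega
    by_cases x = 8 * s
    · refine ⟨4 * s, by omega, by omega, Or.inr ?_⟩
      simp only [a]
      split_ifs <;> omega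
    by_cases x = 2 * s
    · refine ⟨4 * s - 1, by omega, by omega, Or.inl ?_⟩
      simp only [a]
      split_ifs <;> omega
    by_cases x = 6 * s - 1
    · refine ⟨4 * s - 1, by omega, by omega, Or.inr ?_⟩
      simp only [a]
      split_ifs <;> omega
    by_cases x = 7 * s
    · refine ⟨1, by omega, by omega, Or.inl ?_⟩
      simp only [a]
      split_ifs <;> first | omega | contradiction
    by_cases x = 7 * s + 1
    · refine ⟨1, by omega, by omega, Or.inr ?_⟩
      simp only [a]
      split_ifs <;> first | omega | contradiction
    by_cases x = 6 * s
    · refine ⟨2 * s + 1, by omega, by omega, Or.inl ?_⟩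
      simp only [a]
      split_ifs <;> omega
    by_cases x = 8 * s + 1
    · refine ⟨2 * s + 1, by omega, by omega, Or.inr ?_⟩
      simp only [a]
      split_ifs <;> omega
    by_cases x ≤ 2 * s - 1
    · refine ⟨2 * (2 * s - x), by omega, by omega, Or.inl ?_⟩
      simp only [a]
      split_ifs <;> omega
    by_cases x ≤ 4 * s - 1
    · refine ⟨2 * (x - 2 * s), by omega, by omega, Or.inr ?_⟩
      simp only [a]
      split_ifs <;> omega
    by_cases x ≤ 5 * s - 1
    · refine ⟨12 * s + 1 - 2 * x, by omega, by omega, Or.inl ?_⟩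
      simp only [a]
      split_ifs <;> omega
    by_cases x ≤ 6 * s - 2
    · refine ⟨12 * s - 1 - 2 * x, by omega, by omega, Or.inl ?_⟩
      simp only [a]
      split_ifs <;> omega
    by_cases x ≤ 7 * s - 1
    · refine ⟨2 * x - (12 * s - 1), by omega, by omega, Or.inr ?_⟩
      simp only [a]
      split_ifs <;> omega
    · refine ⟨2 * x - (12 * s + 1), by omega, by omega, Or.inr ?_⟩
      simp only [a]
      split_ifs <;> omega

/-- `{1, …, 3n + 1} \ {2n + 1}` splits into triples `{i + 1, a i, a i + (i + 1)}`. -/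
lemma exists_zero_sum_triples (n : ℕ) (hn : 3 ≤ n) (h : n % 4 = 0 ∨ n % 4 = 3) : ∃ a : ℕ → ℕ,
    (∀ i < n, n < a i ∧ a i + (i + 1) ≤ 3 * n + 1) ∧
    ∀ x, 1 ≤ x → x ≤ 3 * n + 1 → x ≠ 2 * n + 1 →
      ∃ i < n, x = i + 1 ∨ x = a i ∨ x = a i + (i + 1) := by
  have key : ∃ a : ℕ → ℕ, (∀ r, 1 ≤ r → r ≤ n → 1 ≤ a r ∧ a r + r ≤ 2 * n + 1) ∧
      ∀ x, 1 ≤ x → x ≤ 2 * n + 1 → x ≠ n + 1 →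
        ∃ r, 1 ≤ r ∧ r ≤ n ∧ (x = a r ∨ x = a r + r) := by
    by_cases h3 : n = 3
    · subst h3
      refine ⟨fun r => if r = 1 then 6 else r - 1, ?_, ?_⟩
      · intro r h1 h2
        dsimp only
        split_ifs <;> omega
      · intro x h1 h2 h3
        interval_cases x
        exacts [⟨2, by simp⟩, ⟨3, by simp⟩, ⟨2, by simp⟩, absurd rfl h3, ⟨3, by simp⟩, ⟨1, by simp⟩,
          ⟨1, by simp⟩]
    by_cases h4 : n = 4
    · subst h4
      refine ⟨fun r => if r = 1 then 8 else if r = 2 then 1 else if r = 3 then 4 else 2, ?_, ?_⟩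
      · intro r h1 h2
        dsimp only
        split_ifs <;> omega
      · intro x h1 h2 h3
        interval_cases x
        exacts [⟨2, by simp⟩, ⟨4, by simp⟩, ⟨2, by simp⟩, ⟨3, by simp⟩, absurd rfl h3, ⟨4, by simp⟩,
          ⟨3, by simp⟩, ⟨1, by simp⟩, ⟨1, by simp⟩]
    rcases h with h | h
    · obtain ⟨s, rfl⟩ : ∃ s, n = 4 * s := ⟨n / 4, by omega⟩
      obtain ⟨a, h1, h2⟩ := exists_rosa_of_mod_four_eq_zero s (by omega)
      exact ⟨a, fun r hr hr' => by have := h1 r hr hr'; omega,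
        fun x hx hx' hx'' => h2 x hx (by omega) (by omega)⟩
    · obtain ⟨s, rfl⟩ : ∃ s, n = 4 * s + 3 := ⟨n / 4, by omega⟩
      obtain ⟨a, h1, h2⟩ := exists_rosa_of_mod_four_eq_three s (by omega)
      exact ⟨a, fun r hr hr' => by have := h1 r hr hr'; omega,
        fun x hx hx' hx'' => h2 x hx (by omega) (by omega)⟩
  obtain ⟨a, ha, hcov⟩ := key
  -- Shifting by n puts the pairs above the differences 1, …, n and moves the hole n+1 to 2n+1, the
  -- excluded multiple.
  refine ⟨fun i => n + a (i + 1), ?_, ?_⟩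
  · intro i hi
    have := ha (i + 1) (by omega) (by omega)
    dsimp only
    omega
  · intro x h1 h2 h3
    by_cases hx : x ≤ n
    · exact ⟨x - 1, by omega, Or.inl (by omega)⟩
    obtain ⟨r, hr1, hr2, hr⟩ := hcov (x - n) (by omega) (by omega) (by omega)
    obtain ⟨i, rfl⟩ : ∃ i, r = i + 1 := ⟨r - 1, by omega⟩
    exact ⟨i, by omega, by dsimp only; omega⟩

/-! ### Integer cycles for k = 3, 7, 9 built on a zero-sum triple. -/

lemma existsOrthogonalCyclic_three_of_cover (n : ℕ) (a : ℕ → ℕ)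
    (ha : ∀ i < n, n < a i ∧ a i + (i + 1) ≤ 3 * n + 1)
    (hcover : ∀ d, 2 * d ≤ 3 * (2 * n + 1) → (∀ c, d ≠ c * (2 * n + 1)) → ∃ i < n,
      d = i + 1 ∨ d = a i ∨ d = a i + (i + 1)) :
    ExistsOrthogonalCyclic n 3 := by
  refine exists_orthogonal_of_base_cycles n 3 (by norm_num)
    (fun i => ![0, i + 1, -a i])
    ?_ ?_ ?_ ?_ ?_
  · intro i hi
    have hha := ha i hi
    apply injective_of_forall_lt_ne
    simp [Fin.forall_fin_succ]
    and_intros <;> omega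
  · intro i hi
    have hha := ha i hi
    -- The window starts at n + 1 - N, since no entry or consecutive sum exceeds i + 1 ≤ n. The same
    -- choice serves k = 7 and k = 9.
    refine ⟨-5 * n - 2, ?_⟩
    simp [Fin.forall_fin_succ]
    and_intros <;> omega
  · intro i hi
    have hha := ha i hi
    apply injective_of_forall_lt_ne
    simp [Fin.forall_fin_succ]
    and_intros <;> omega
  · intro i hi
    have hha := ha i hi
    refine ⟨-5 * n - 2, ?_⟩
    simp [Fin.forall_fin_succ]
    and_intros <;> omega
  · intro d h1 h2
    obtain ⟨i, hi, h⟩ := hcover d h1 h2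
    refine ⟨i, hi, ?_⟩
    rcases h with rfl | rfl | rfl
    · exact ⟨0, Or.inl (by simp)⟩
    · exact ⟨2, Or.inl (by simp)⟩
    · exact ⟨1, Or.inr (by simp; omega)⟩

/-- Going around, the signed differences are i+1, -(a+i+1), -(Q+e), Q, a, -P, P+e. The pairs P, P+e
and Q, Q+e have the same gap e and cancel, so the triple still closes. -/
lemma existsOrthogonalCyclic_seven_of_cover (n : ℕ) (hn : 7 ≤ n) (a P Q e : ℕ → ℕ)
    (ha : ∀ i < n, n < a i ∧ a i + (i + 1) ≤ 3 * n + 1)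
    (hP : ∀ i < n, 3 * n + 1 < P i ∧ Q i + e i ≤ 7 * n + 3 ∧
      ((Q i = P i + n + 1 ∧ e i = 1) ∨ (Q i = P i + n + 2 ∧ e i = 1) ∨
        (P i = 4 * n + 1 ∧ Q i = 6 * n + 2 ∧ e i = 2)))
    (hcover : ∀ d, 2 * d ≤ 7 * (2 * n + 1) → (∀ c, d ≠ c * (2 * n + 1)) → ∃ i < n,
      d = i + 1 ∨ d = a i ∨ d = a i + (i + 1) ∨ d = P i ∨ d = P i + e i ∨
      d = Q i ∨ d = Q i + e i) :
    ExistsOrthogonalCyclic n 7 := by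
  refine exists_orthogonal_of_base_cycles n 7 (by norm_num)
    (fun i => ![0, i + 1, -a i, -a i - Q i - e i, -a i - e i, -e i, -e i - P i])
    ?_ ?_ ?_ ?_ ?_
  · intro i hi
    have hha := ha i hi
    have hhP := hP i hi
    apply injective_of_forall_lt_ne
    simp [Fin.forall_fin_succ]
    and_intros <;> omega
  · intro i hi
    have hha := ha i hi
    have hhP := hP i hi
    refine ⟨-13 * n - 6, ?_⟩
    simp [Fin.forall_fin_succ]
    and_intros <;> omega
  · intro i hi
    have hha := ha i hi
    have hhP := hP i hi
    apply injective_of_forall_lt_ne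
    simp [Fin.forall_fin_succ]
    and_intros <;> omega
  · intro i hi
    have hha := ha i hi
    have hhP := hP i hi
    refine ⟨-13 * n - 6, ?_⟩
    simp [Fin.forall_fin_succ]
    and_intros <;> omega
  · intro d h1 h2
    obtain ⟨i, hi, h⟩ := hcover d h1 h2
    refine ⟨i, hi, ?_⟩
    rcases h with rfl | rfl | rfl | rfl | rfl | rfl | rfl
    · exact ⟨0, Or.inl (by simp)⟩
    · exact ⟨4, Or.inl (by simp; omega)⟩
    · exact ⟨1, Or.inr (by simp; omega)⟩
    · exact ⟨5, Or.inr (by simp)⟩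
    · exact ⟨6, Or.inl (by simp)⟩
    · exact ⟨3, Or.inl (by simp)⟩
    · exact ⟨2, Or.inr (by simp; omega)⟩

/-- Three pairs are added to the triple: the gaps 1 of P and of W together cancel the gap 2 of Q. -/
lemma existsOrthogonalCyclic_nine_of_cover (n : ℕ) (hn : 9 ≤ n) (a P Q W : ℕ → ℕ)
    (ha : ∀ i < n, n < a i ∧ a i + (i + 1) ≤ 3 * n + 1)
    (hP : ∀ i < n, 3 * n + 1 < P i ∧ P i + 2 < Q i ∧ Q i + 2 < W i ∧ W i + 1 ≤ 9 * n + 4)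
    (hcover : ∀ d, 2 * d ≤ 9 * (2 * n + 1) → (∀ c, d ≠ c * (2 * n + 1)) → ∃ i < n,
      d = i + 1 ∨ d = a i ∨ d = a i + (i + 1) ∨ d = P i ∨ d = P i + 1 ∨
      d = Q i ∨ d = Q i + 2 ∨ d = W i ∨ d = W i + 1) :
    ExistsOrthogonalCyclic n 9 := by
  refine exists_orthogonal_of_base_cycles n 9 (by norm_num)
    (fun i => ![0, i + 1, -a i, -a i - W i - 1, -a i - 1, -1, -P i - 2, -2, -Q i - 2])
    ?_ ?_ ?_ ?_ ?_
  · intro i hi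
    have hha := ha i hi
    have hhP := hP i hi
    apply injective_of_forall_lt_ne
    simp [Fin.forall_fin_succ]
    and_intros <;> omega
  · intro i hi
    have hha := ha i hi
    have hhP := hP i hi
    refine ⟨-17 * n - 8, ?_⟩
    simp [Fin.forall_fin_succ]
    and_intros <;> omega
  · intro i hi
    have hha := ha i hi
    have hhP := hP i hi
    apply injective_of_forall_lt_ne
    simp [Fin.forall_fin_succ]
    and_intros <;> omega
  · intro i hi
    have hha := ha i hi
    have hhP := hP i hi
    refine ⟨-17 * n - 8, ?_⟩
    simp [Fin.forall_fin_succ]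
    and_intros <;> omega
  · intro d h1 h2
    obtain ⟨i, hi, h⟩ := hcover d h1 h2
    refine ⟨i, hi, ?_⟩
    rcases h with rfl | rfl | rfl | rfl | rfl | rfl | rfl | rfl | rfl
    · exact ⟨0, Or.inl (by simp)⟩
    · exact ⟨4, Or.inl (by simp; omega)⟩
    · exact ⟨1, Or.inr (by simp; omega)⟩
    · exact ⟨6, Or.inl (by simp; omega)⟩
    · exact ⟨5, Or.inr (by simp; omega)⟩
    · exact ⟨7, Or.inr (by simp; omega)⟩
    · exact ⟨8, Or.inl (by simp; omega)⟩
    · exact ⟨3, Or.inl (by simp)⟩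
    · exact ⟨2, Or.inr (by simp; omega)⟩

/-! ### Even k: 4, 8 and 6. -/

/-- Cycle i takes the pair c(2n+1)+2i+1, c(2n+1)+2i+2 from each of the two blocks c = 0, 1 between
multiples of 2n+1. The gaps 1 cancel. -/
theorem existsOrthogonalCyclic_four (n : ℕ) (hn : 4 ≤ n) : ExistsOrthogonalCyclic n 4 := by
  refine exists_orthogonal_of_base_cycles n 4 (by norm_num)
    (fun i => ![0, 2 * i + 1, -1, -(2 * i + 1) - (2 * n + 1) - 1])
    ?_ ?_ ?_ ?_ ?_
  · intro i hi
    apply injective_of_forall_lt_ne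
    simp [Fin.forall_fin_succ]
    and_intros <;> omega
  · intro i hi
    refine ⟨-4 * n - 2, ?_⟩
    simp [Fin.forall_fin_succ]
    and_intros <;> omega
  · intro i hi
    apply injective_of_forall_lt_ne
    simp [Fin.forall_fin_succ]
    and_intros <;> omega
  · intro i hi
    refine ⟨-4 * n - 2, ?_⟩
    simp [Fin.forall_fin_succ]
    and_intros <;> omega
  · intro d h1 h2
    have hd0 := h2 0
    have hd1 := h2 1
    have hd2 := h2 2
    by_cases d < 1 * (2 * n + 1) ∧ (d - 0 * (2 * n + 1)) % 2 = 1
    · exact ⟨(d - (0 * (2 * n + 1) + 1)) / 2, by omega, 0, Or.inl (by simp; omega)⟩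
    by_cases d < 1 * (2 * n + 1)
    · exact ⟨(d - (0 * (2 * n + 1) + 1)) / 2, by omega, 1, Or.inr (by simp; omega)⟩
    by_cases d < 2 * (2 * n + 1) ∧ (d - 1 * (2 * n + 1)) % 2 = 1
    · exact ⟨(d - (1 * (2 * n + 1) + 1)) / 2, by omega, 2, Or.inr (by simp; omega)⟩
    · exact ⟨(d - (1 * (2 * n + 1) + 1)) / 2, by omega, 3, Or.inl (by simp; omega)⟩

/-- As for k = 4, now with the four blocks c = 0, …, 3. The pairs from blocks 1 and 2 are
interleaved along the cycle. -/
theorem existsOrthogonalCyclic_eight (n : ℕ) (hn : 8 ≤ n) : ExistsOrthogonalCyclic n 8 := by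
  refine exists_orthogonal_of_base_cycles n 8 (by norm_num)
    (fun i => ![0, 2 * i + 1, -1, -1 - (2 * i + 1) - (2 * n + 1), 2 * n, 2 * i + 1 + 2 * (2 * n + 1),
      -(2 * n + 1), 2 * i + 2 + 2 * (2 * n + 1)])
    ?_ ?_ ?_ ?_ ?_
  · intro i hi
    apply injective_of_forall_lt_ne
    simp [Fin.forall_fin_succ]
    and_intros <;> omega
  · intro i hi
    refine ⟨-8 * n - 4, ?_⟩
    simp [Fin.forall_fin_succ]
    and_intros <;> omega
  · intro i hi
    apply injective_of_forall_lt_ne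
    simp [Fin.forall_fin_succ]
    and_intros <;> omega
  · intro i hi
    refine ⟨-8 * n - 4, ?_⟩
    simp [Fin.forall_fin_succ]
    and_intros <;> omega
  · intro d h1 h2
    have hd0 := h2 0
    have hd1 := h2 1
    have hd2 := h2 2
    have hd3 := h2 3
    have hd4 := h2 4
    by_cases d < 1 * (2 * n + 1) ∧ (d - 0 * (2 * n + 1)) % 2 = 1
    · exact ⟨(d - (0 * (2 * n + 1) + 1)) / 2, by omega, 0, Or.inl (by simp; omega)⟩
    by_cases d < 1 * (2 * n + 1)
    · exact ⟨(d - (0 * (2 * n + 1) + 1)) / 2, by omega, 1, Or.inr (by simp; omega)⟩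
    by_cases d < 2 * (2 * n + 1) ∧ (d - 1 * (2 * n + 1)) % 2 = 1
    · exact ⟨(d - (1 * (2 * n + 1) + 1)) / 2, by omega, 2, Or.inr (by simp; omega)⟩
    by_cases d < 2 * (2 * n + 1)
    · exact ⟨(d - (1 * (2 * n + 1) + 1)) / 2, by omega, 4, Or.inl (by simp; omega)⟩
    by_cases d < 3 * (2 * n + 1) ∧ (d - 2 * (2 * n + 1)) % 2 = 1
    · exact ⟨(d - (2 * (2 * n + 1) + 1)) / 2, by omega, 3, Or.inl (by simp; omega)⟩
    by_cases d < 3 * (2 * n + 1)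
    · exact ⟨(d - (2 * (2 * n + 1) + 1)) / 2, by omega, 7, Or.inr (by simp; omega)⟩
    by_cases d < 4 * (2 * n + 1) ∧ (d - 3 * (2 * n + 1)) % 2 = 1
    · exact ⟨(d - (3 * (2 * n + 1) + 1)) / 2, by omega, 5, Or.inr (by simp; omega)⟩
    · exact ⟨(d - (3 * (2 * n + 1) + 1)) / 2, by omega, 6, Or.inl (by simp; omega)⟩

/-- Two pairs with gap 1, one from each upper block, cancel a pair with gap 2 from 1, …, 2n. For the
latter, 2n must be divisible by 4: each four consecutive numbers split as {1, 3}, {2, 4}. -/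
theorem existsOrthogonalCyclic_six (n : ℕ) (hn : 6 ≤ n) (hev : Even n) : ExistsOrthogonalCyclic n 6 := by
  obtain ⟨t, ht⟩ := hev
  refine exists_orthogonal_of_base_cycles n 6 (by norm_num)
    (fun i => ![0, 4 * (i / 2) + i % 2 + 1, -2, -2 - (2 * n + 2 + 2 * i), -1,
      -1 - (2 * (2 * n + 1) + 1 + 2 * i)])
    ?_ ?_ ?_ ?_ ?_
  · intro i hi
    apply injective_of_forall_lt_ne
    simp [Fin.forall_fin_succ]
    and_intros <;> omega
  · intro i hi
    refine ⟨-6 * n - 3, ?_⟩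
    simp [Fin.forall_fin_succ]
    and_intros <;> omega
  · intro i hi
    apply injective_of_forall_lt_ne
    simp [Fin.forall_fin_succ]
    and_intros <;> omega
  · intro i hi
    refine ⟨-6 * n - 3, ?_⟩
    simp [Fin.forall_fin_succ]
    and_intros <;> omega
  · intro d h1 h2
    have hd0 := h2 0
    have hd1 := h2 1
    have hd2 := h2 2
    have hd3 := h2 3
    by_cases d < 2 * n + 1 ∧ (d - 1) % 4 < 2
    · exact ⟨2 * ((d - 1) / 4) + (d - 1) % 2, by omega, 0, Or.inl (by simp; omega)⟩
    by_cases d < 2 * n + 1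
    · exact ⟨2 * ((d - 1) / 4) + (d - 1) % 2, by omega, 1, Or.inr (by simp; omega)⟩
    by_cases d < 2 * (2 * n + 1) ∧ (d - 1 * (2 * n + 1)) % 2 = 1
    · exact ⟨(d - (1 * (2 * n + 1) + 1)) / 2, by omega, 2, Or.inr (by simp; omega)⟩
    by_cases d < 2 * (2 * n + 1)
    · exact ⟨(d - (1 * (2 * n + 1) + 1)) / 2, by omega, 3, Or.inl (by simp; omega)⟩
    by_cases d < 3 * (2 * n + 1) ∧ (d - 2 * (2 * n + 1)) % 2 = 1
    · exact ⟨(d - (2 * (2 * n + 1) + 1)) / 2, by omega, 4, Or.inr (by simp; omega)⟩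
    · exact ⟨(d - (2 * (2 * n + 1) + 1)) / 2, by omega, 5, Or.inl (by simp; omega)⟩

/-! ### k = 3, 7, 9: pairing off the differences above 3n+1. -/

lemma existsOrthogonalCyclic_three (n : ℕ) (hn : 3 ≤ n) (h : n % 4 = 0 ∨ n % 4 = 3) :
    ExistsOrthogonalCyclic n 3 := by
  obtain ⟨a, ha, hcov⟩ := exists_zero_sum_triples n hn h
  refine existsOrthogonalCyclic_three_of_cover n a ha ?_
  intro d h1 h2
  have hd0 := h2 0
  have hd1 := h2 1
  exact hcov d (by omega) (by omega) (by omega)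

lemma existsOrthogonalCyclic_seven_of_mod_four_eq_zero (n : ℕ) (hn : 7 ≤ n) (h : n % 4 = 0) :
    ExistsOrthogonalCyclic n 7 := by
  obtain ⟨a, ha, hcov⟩ := exists_zero_sum_triples n (by omega) (by omega)
  obtain ⟨s, hs⟩ : ∃ s, n = 4 * s := ⟨n / 4, by omega⟩
  -- As n is even, pairs of consecutive numbers fill the gaps around the holes 4n+2 and 6n+3. P
  -- takes 3n+2, …, 4n+1 and 5n+3, …, 6n+2; Q takes 4n+3, …, 5n+2 and 6n+4, …, 7n+3.
  let P : ℕ → ℕ := fun i =>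
    if i < 2 * s then 3 * n + 2 + 2 * i else 4 * n + 3 + 2 * i
  let Q : ℕ → ℕ := fun i =>
    if i < 2 * s then 4 * n + 3 + 2 * i else 5 * n + 4 + 2 * i
  let e : ℕ → ℕ := fun i =>
    1
  refine existsOrthogonalCyclic_seven_of_cover n hn a P Q e ha ?_ ?_
  · intro i hi
    simp only [P, Q, e]
    split_ifs <;> simp <;> omega
  · intro d h1 h2
    have hd0 := h2 0
    have hd1 := h2 1
    have hd2 := h2 2
    have hd3 := h2 3
    by_cases hd : d ≤ 3 * n + 1
    · obtain ⟨i, hi, h⟩ := hcov d (by omega) hd (by omega)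
      exact ⟨i, hi, by tauto⟩
    by_cases d ≤ 4 * n + 1 ∧ d % 2 = 0
    · refine ⟨(d - (3 * n + 2)) / 2, by omega, Or.inr (Or.inr (Or.inr (Or.inl ?_)))⟩
      simp only [P]
      split_ifs <;> omega
    by_cases d ≤ 4 * n + 1
    · refine ⟨(d - (3 * n + 2)) / 2, by omega, Or.inr (Or.inr (Or.inr (Or.inr (Or.inl ?_))))⟩
      simp only [P, e]
      split_ifs <;> omega
    by_cases d ≤ 5 * n + 2 ∧ d % 2 = 1
    · refine ⟨(d - (4 * n + 3)) / 2, by omega, Or.inr (Or.inr (Or.inr (Or.inr (Or.inr (Or.inl ?_)))))⟩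
      simp only [Q]
      split_ifs <;> omega
    by_cases d ≤ 5 * n + 2
    · refine ⟨(d - (4 * n + 3)) / 2, by omega, Or.inr (Or.inr (Or.inr (Or.inr (Or.inr (Or.inr (?_))))))⟩
      simp only [Q, e]
      split_ifs <;> omega
    by_cases d ≤ 6 * n + 2 ∧ d % 2 = 1
    · refine ⟨(d - (4 * n + 3)) / 2, by omega, Or.inr (Or.inr (Or.inr (Or.inl ?_)))⟩
      simp only [P]
      split_ifs <;> omega
    by_cases d ≤ 6 * n + 2
    · refine ⟨(d - (4 * n + 3)) / 2, by omega, Or.inr (Or.inr (Or.inr (Or.inr (Or.inl ?_))))⟩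
      simp only [P, e]
      split_ifs <;> omega
    by_cases d % 2 = 0
    · refine ⟨(d - (5 * n + 4)) / 2, by omega, Or.inr (Or.inr (Or.inr (Or.inr (Or.inr (Or.inl ?_)))))⟩
      simp only [Q]
      split_ifs <;> omega
    · refine ⟨(d - (5 * n + 4)) / 2, by omega, Or.inr (Or.inr (Or.inr (Or.inr (Or.inr (Or.inr (?_))))))⟩
      simp only [Q, e]
      split_ifs <;> omega

lemma existsOrthogonalCyclic_seven_of_mod_four_eq_three (n : ℕ) (hn : 7 ≤ n) (h : n % 4 = 3) :
    ExistsOrthogonalCyclic n 7 := by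
  obtain ⟨a, ha, hcov⟩ := exists_zero_sum_triples n (by omega) (by omega)
  obtain ⟨s, hs⟩ : ∃ s, n = 4 * s + 3 := ⟨n / 4, by omega⟩
  -- For odd n, parity leaves one number on each side of each hole. Index 0 takes them as the gap-2
  -- pairs {4n+1, 4n+3} and {6n+2, 6n+4}.
  let P : ℕ → ℕ := fun i =>
    if i = 0 then 4 * n + 1 else if i ≤ 2 * s + 1 then 3 * n + 2 * i else 4 * n + 2 + 2 * i
  let Q : ℕ → ℕ := fun i =>
    if i = 0 then 6 * n + 2 else if i ≤ 2 * s + 1 then 4 * n + 2 + 2 * i else 5 * n + 4 + 2 * i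
  let e : ℕ → ℕ := fun i =>
    if i = 0 then 2 else 1
  refine existsOrthogonalCyclic_seven_of_cover n hn a P Q e ha ?_ ?_
  · intro i hi
    simp only [P, Q, e]
    split_ifs <;> omega
  · intro d h1 h2
    have hd0 := h2 0
    have hd1 := h2 1
    have hd2 := h2 2
    have hd3 := h2 3
    by_cases hd : d ≤ 3 * n + 1
    · obtain ⟨i, hi, h⟩ := hcov d (by omega) hd (by omega)
      exact ⟨i, hi, by tauto⟩
    by_cases d ≤ 4 * n ∧ d % 2 = 1
    · refine ⟨(d - 3 * n) / 2, by omega, Or.inr (Or.inr (Or.inr (Or.inl ?_)))⟩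
      simp only [P]
      split_ifs <;> omega
    by_cases d ≤ 4 * n
    · refine ⟨(d - 3 * n) / 2, by omega, Or.inr (Or.inr (Or.inr (Or.inr (Or.inl ?_))))⟩
      simp only [P, e]
      split_ifs <;> omega
    by_cases d = 4 * n + 1
    · refine ⟨0, by omega, Or.inr (Or.inr (Or.inr (Or.inl ?_)))⟩
      simp only [P]
      split_ifs <;> omega
    by_cases d = 4 * n + 3
    · refine ⟨0, by omega, Or.inr (Or.inr (Or.inr (Or.inr (Or.inl ?_))))⟩
      simp only [P, e]
      split_ifs <;> omega
    by_cases d ≤ 5 * n + 2 ∧ d % 2 = 0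
    · refine ⟨(d - (4 * n + 2)) / 2, by omega, Or.inr (Or.inr (Or.inr (Or.inr (Or.inr (Or.inl ?_)))))⟩
      simp only [Q]
      split_ifs <;> omega
    by_cases d ≤ 5 * n + 2
    · refine ⟨(d - (4 * n + 2)) / 2, by omega, Or.inr (Or.inr (Or.inr (Or.inr (Or.inr (Or.inr (?_))))))⟩
      simp only [Q, e]
      split_ifs <;> omega
    by_cases d ≤ 6 * n + 1 ∧ d % 2 = 0
    · refine ⟨(d - (4 * n + 2)) / 2, by omega, Or.inr (Or.inr (Or.inr (Or.inl ?_)))⟩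
      simp only [P]
      split_ifs <;> omega
    by_cases d ≤ 6 * n + 1
    · refine ⟨(d - (4 * n + 2)) / 2, by omega, Or.inr (Or.inr (Or.inr (Or.inr (Or.inl ?_))))⟩
      simp only [P, e]
      split_ifs <;> omega
    by_cases d = 6 * n + 2
    · refine ⟨0, by omega, Or.inr (Or.inr (Or.inr (Or.inr (Or.inr (Or.inl ?_)))))⟩
      simp only [Q]
      split_ifs <;> omega
    by_cases d = 6 * n + 4
    · refine ⟨0, by omega, Or.inr (Or.inr (Or.inr (Or.inr (Or.inr (Or.inr (?_))))))⟩
      simp only [Q, e]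
      split_ifs <;> omega
    by_cases d % 2 = 1
    · refine ⟨(d - (5 * n + 4)) / 2, by omega, Or.inr (Or.inr (Or.inr (Or.inr (Or.inr (Or.inl ?_)))))⟩
      simp only [Q]
      split_ifs <;> omega
    · refine ⟨(d - (5 * n + 4)) / 2, by omega, Or.inr (Or.inr (Or.inr (Or.inr (Or.inr (Or.inr (?_))))))⟩
      simp only [Q, e]
      split_ifs <;> omega

lemma existsOrthogonalCyclic_nine_of_mod_four_eq_zero (n : ℕ) (hn : 9 ≤ n) (h : n % 4 = 0) :
    ExistsOrthogonalCyclic n 9 := by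
  obtain ⟨a, ha, hcov⟩ := exists_zero_sum_triples n (by omega) (by omega)
  obtain ⟨s, hs⟩ : ∃ s, n = 4 * s := ⟨n / 4, by omega⟩
  -- P fills the range up to 5n+2 and W the range from 7n+4 with consecutive pairs. Q fills the two
  -- middle stretches of length n with gap-2 pairs, in blocks of four, using 4 ∣ n.
  let P : ℕ → ℕ := fun i =>
    if i < 2 * s then 3 * n + 2 + 2 * i else 3 * n + 3 + 2 * i
  let Q : ℕ → ℕ := fun i =>
    if i < 2 * s then 5 * n + 3 + 4 * (i / 2) + i % 2
    else 6 * n + 4 + 4 * ((i - 2 * s) / 2) + (i - 2 * s) % 2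
  let W : ℕ → ℕ := fun i =>
    if i < 2 * s then 7 * n + 4 + 2 * i else 7 * n + 5 + 2 * i
  refine existsOrthogonalCyclic_nine_of_cover n hn a P Q W ha ?_ ?_
  · intro i hi
    simp only [P, Q, W]
    split_ifs <;> omega
  · intro d h1 h2
    have hd0 := h2 0
    have hd1 := h2 1
    have hd2 := h2 2
    have hd3 := h2 3
    have hd4 := h2 4
    by_cases hd : d ≤ 3 * n + 1
    · obtain ⟨i, hi, h⟩ := hcov d (by omega) hd (by omega)
      exact ⟨i, hi, by tauto⟩
    by_cases d ≤ 4 * n + 1 ∧ d % 2 = 0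
    · refine ⟨(d - (3 * n + 2)) / 2, by omega, Or.inr (Or.inr (Or.inr (Or.inl ?_)))⟩
      simp only [P]
      split_ifs <;> omega
    by_cases d ≤ 4 * n + 1
    · refine ⟨(d - (3 * n + 2)) / 2, by omega, Or.inr (Or.inr (Or.inr (Or.inr (Or.inl ?_))))⟩
      simp only [P]
      split_ifs <;> omega
    by_cases d ≤ 5 * n + 2 ∧ d % 2 = 1
    · refine ⟨(d - (3 * n + 3)) / 2, by omega, Or.inr (Or.inr (Or.inr (Or.inl ?_)))⟩
      simp only [P]
      split_ifs <;> omega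
    by_cases d ≤ 5 * n + 2
    · refine ⟨(d - (3 * n + 3)) / 2, by omega, Or.inr (Or.inr (Or.inr (Or.inr (Or.inl ?_))))⟩
      simp only [P]
      split_ifs <;> omega
    by_cases d ≤ 6 * n + 2 ∧ (d - (5 * n + 3)) % 4 < 2
    · refine ⟨0 + 2 * ((d - (5 * n + 3)) / 4) + (d - (5 * n + 3)) % 2, by omega, Or.inr (Or.inr (Or.inr (Or.inr (Or.inr (Or.inl ?_)))))⟩
      simp only [Q]
      split_ifs <;> omega
    by_cases d ≤ 6 * n + 2
    · refine ⟨0 + 2 * ((d - (5 * n + 3)) / 4) + (d - (5 * n + 3)) % 2, by omega, Or.inr (Or.inr (Or.inr (Or.inr (Or.inr (Or.inr (Or.inl ?_))))))⟩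
      simp only [Q]
      split_ifs <;> omega
    by_cases d ≤ 7 * n + 3 ∧ (d - (6 * n + 4)) % 4 < 2
    · refine ⟨2 * s + 2 * ((d - (6 * n + 4)) / 4) + (d - (6 * n + 4)) % 2, by omega, Or.inr (Or.inr (Or.inr (Or.inr (Or.inr (Or.inl ?_)))))⟩
      simp only [Q]
      split_ifs <;> omega
    by_cases d ≤ 7 * n + 3
    · refine ⟨2 * s + 2 * ((d - (6 * n + 4)) / 4) + (d - (6 * n + 4)) % 2, by omega, Or.inr (Or.inr (Or.inr (Or.inr (Or.inr (Or.inr (Or.inl ?_))))))⟩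
      simp only [Q]
      split_ifs <;> omega
    by_cases d ≤ 8 * n + 3 ∧ d % 2 = 0
    · refine ⟨(d - (7 * n + 4)) / 2, by omega, Or.inr (Or.inr (Or.inr (Or.inr (Or.inr (Or.inr (Or.inr (Or.inl ?_)))))))⟩
      simp only [W]
      split_ifs <;> omega
    by_cases d ≤ 8 * n + 3
    · refine ⟨(d - (7 * n + 4)) / 2, by omega, Or.inr (Or.inr (Or.inr (Or.inr (Or.inr (Or.inr (Or.inr (Or.inr (?_))))))))⟩
      simp only [W]
      split_ifs <;> omega
    by_cases d % 2 = 1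
    · refine ⟨(d - (7 * n + 5)) / 2, by omega, Or.inr (Or.inr (Or.inr (Or.inr (Or.inr (Or.inr (Or.inr (Or.inl ?_)))))))⟩
      simp only [W]
      split_ifs <;> omega
    · refine ⟨(d - (7 * n + 5)) / 2, by omega, Or.inr (Or.inr (Or.inr (Or.inr (Or.inr (Or.inr (Or.inr (Or.inr (?_))))))))⟩
      simp only [W]
      split_ifs <;> omega

lemma existsOrthogonalCyclic_nine_of_mod_four_eq_three (n : ℕ) (hn : 9 ≤ n) (h : n % 4 = 3) :
    ExistsOrthogonalCyclic n 9 := by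
  obtain ⟨a, ha, hcov⟩ := exists_zero_sum_triples n (by omega) (by omega)
  obtain ⟨s, hs⟩ : ∃ s, n = 4 * s + 3 := ⟨n / 4, by omega⟩
  let P : ℕ → ℕ := fun i =>
    if i < 2 * s + 1 then 3 * n + 2 + 2 * i else 3 * n + 5 + 2 * i
  -- The three exceptional gap-2 pairs straddle the holes 4n+2, 6n+3 and 8n+4; the others come from
  -- blocks of four.
  let Q : ℕ → ℕ := fun i =>
    if i = 0 then 4 * n + 1
    else if i < 2 * s + 1 then 5 * n + 5 + 4 * ((i - 1) / 2) + (i - 1) % 2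
    else if i = 2 * s + 1 then 6 * n + 2
    else if i < 4 * s + 2 then 6 * n + 5 + 4 * ((i - (2 * s + 2)) / 2) + (i - (2 * s + 2)) % 2
    else 8 * n + 3
  let W : ℕ → ℕ := fun i =>
    if i ≤ 2 * s + 1 then 7 * n + 2 + 2 * i else 7 * n + 5 + 2 * i
  refine existsOrthogonalCyclic_nine_of_cover n hn a P Q W ha ?_ ?_
  · intro i hi
    simp only [P, Q, W]
    split_ifs <;> omega
  · intro d h1 h2
    have hd0 := h2 0
    have hd1 := h2 1
    have hd2 := h2 2
    have hd3 := h2 3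
    have hd4 := h2 4
    by_cases hd : d ≤ 3 * n + 1
    · obtain ⟨i, hi, h⟩ := hcov d (by omega) hd (by omega)
      exact ⟨i, hi, by tauto⟩
    by_cases d ≤ 4 * n ∧ d % 2 = 1
    · refine ⟨(d - (3 * n + 2)) / 2, by omega, Or.inr (Or.inr (Or.inr (Or.inl ?_)))⟩
      simp only [P]
      split_ifs <;> omega
    by_cases d ≤ 4 * n
    · refine ⟨(d - (3 * n + 2)) / 2, by omega, Or.inr (Or.inr (Or.inr (Or.inr (Or.inl ?_))))⟩
      simp only [P]
      split_ifs <;> omega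
    by_cases d = 4 * n + 1
    · refine ⟨0, by omega, Or.inr (Or.inr (Or.inr (Or.inr (Or.inr (Or.inl ?_)))))⟩
      simp only [Q]
      split_ifs <;> omega
    by_cases d = 4 * n + 3
    · refine ⟨0, by omega, Or.inr (Or.inr (Or.inr (Or.inr (Or.inr (Or.inr (Or.inl ?_))))))⟩
      simp only [Q]
      split_ifs <;> omega
    by_cases d ≤ 5 * n + 4 ∧ d % 2 = 0
    · refine ⟨(d - (3 * n + 5)) / 2, by omega, Or.inr (Or.inr (Or.inr (Or.inl ?_)))⟩
      simp only [P]
      split_ifs <;> omega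
    by_cases d ≤ 5 * n + 4
    · refine ⟨(d - (3 * n + 5)) / 2, by omega, Or.inr (Or.inr (Or.inr (Or.inr (Or.inl ?_))))⟩
      simp only [P]
      split_ifs <;> omega
    by_cases d ≤ 6 * n + 1 ∧ (d - (5 * n + 5)) % 4 < 2
    · refine ⟨1 + 2 * ((d - (5 * n + 5)) / 4) + (d - (5 * n + 5)) % 2, by omega, Or.inr (Or.inr (Or.inr (Or.inr (Or.inr (Or.inl ?_)))))⟩
      simp only [Q]
      split_ifs <;> omega
    by_cases d ≤ 6 * n + 1
    · refine ⟨1 + 2 * ((d - (5 * n + 5)) / 4) + (d - (5 * n + 5)) % 2, by omega, Or.inr (Or.inr (Or.inr (Or.inr (Or.inr (Or.inr (Or.inl ?_))))))⟩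
      simp only [Q]
      split_ifs <;> omega
    by_cases d = 6 * n + 2
    · refine ⟨2 * s + 1, by omega, Or.inr (Or.inr (Or.inr (Or.inr (Or.inr (Or.inl ?_)))))⟩
      simp only [Q]
      split_ifs <;> first | omega | contradiction
    by_cases d = 6 * n + 4
    · refine ⟨2 * s + 1, by omega, Or.inr (Or.inr (Or.inr (Or.inr (Or.inr (Or.inr (Or.inl ?_))))))⟩
      simp only [Q]
      split_ifs <;> first | omega | contradiction
    by_cases d ≤ 7 * n + 1 ∧ (d - (6 * n + 5)) % 4 < 2
    · refine ⟨2 * s + 2 + 2 * ((d - (6 * n + 5)) / 4) + (d - (6 * n + 5)) % 2, by omega, Or.inr (Or.inr (Or.inr (Or.inr (Or.inr (Or.inl ?_)))))⟩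
      simp only [Q]
      split_ifs <;> omega
    by_cases d ≤ 7 * n + 1
    · refine ⟨2 * s + 2 + 2 * ((d - (6 * n + 5)) / 4) + (d - (6 * n + 5)) % 2, by omega, Or.inr (Or.inr (Or.inr (Or.inr (Or.inr (Or.inr (Or.inl ?_))))))⟩
      simp only [Q]
      split_ifs <;> omega
    by_cases d ≤ 8 * n + 2 ∧ d % 2 = 1
    · refine ⟨(d - (7 * n + 2)) / 2, by omega, Or.inr (Or.inr (Or.inr (Or.inr (Or.inr (Or.inr (Or.inr (Or.inl ?_)))))))⟩
      simp only [W]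
      split_ifs <;> omega
    by_cases d ≤ 8 * n + 2
    · refine ⟨(d - (7 * n + 2)) / 2, by omega, Or.inr (Or.inr (Or.inr (Or.inr (Or.inr (Or.inr (Or.inr (Or.inr (?_))))))))⟩
      simp only [W]
      split_ifs <;> omega
    by_cases d = 8 * n + 3
    · refine ⟨4 * s + 2, by omega, Or.inr (Or.inr (Or.inr (Or.inr (Or.inr (Or.inl ?_)))))⟩
      simp only [Q]
      split_ifs <;> first | omega | contradiction
    by_cases d = 8 * n + 5
    · refine ⟨4 * s + 2, by omega, Or.inr (Or.inr (Or.inr (Or.inr (Or.inr (Or.inr (Or.inl ?_))))))⟩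
      simp only [Q]
      split_ifs <;> first | omega | contradiction
    by_cases d % 2 = 0
    · refine ⟨(d - (7 * n + 5)) / 2, by omega, Or.inr (Or.inr (Or.inr (Or.inr (Or.inr (Or.inr (Or.inr (Or.inl ?_)))))))⟩
      simp only [W]
      split_ifs <;> omega
    · refine ⟨(d - (7 * n + 5)) / 2, by omega, Or.inr (Or.inr (Or.inr (Or.inr (Or.inr (Or.inr (Or.inr (Or.inr (?_))))))))⟩
      simp only [W]
      split_ifs <;> omega

/-! ### k = 5. -/

-- Cycle i contains 3n+1-i and 3n+2+i, which together run over 2n+2, …, 4n+1 and have gap 2i+1. A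
-- small difference 2i+2, 2i+3 or 2i-1 reduces this gap to 1, 2 or -2, which a pair P, P+1 or P, P+2
-- cancels. The exceptional i = 2t closes with 4t+1, 4t+2 and 4n+6 because n = 4t+3.
set_option maxHeartbeats 1600000 in
lemma existsOrthogonalCyclic_five (n : ℕ) (hn : 5 ≤ n) (h : n % 4 = 3) :
    ExistsOrthogonalCyclic n 5 := by
  obtain ⟨t, ht⟩ : ∃ t, n = 4 * t + 3 := ⟨n / 4, by omega⟩
  -- The pairs use what the other differences leave. Gap 1 (i < 2t): 4n+3, 4n+4 and 4n+8, …, 5n+2.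
  -- Gap 2 (i > 2t): the odd numbers below 4t, the even numbers from 4t+4 to 2n, and lastly {4n+5,
  -- 4n+7}, which straddles the 4n+6 used by i = 2t.
  let P : ℕ → ℕ := fun i =>
    if i = 0 then 4 * n + 3
    else if i < 2 * t then 4 * n + 6 + 2 * i
    else if i < 3 * t + 1 then 4 * (i - (2 * t + 1)) + 1
    else if i < 4 * t + 2 then 4 * (i - (2 * t + 1)) + 4
    else 4 * n + 5
  let x : ℕ → Fin 5 → ℤ := fun i =>
    if i < 2 * t then ![0, 2 * i + 2, i - 3 * n, 1, -P i]
    else if i = 2 * t then ![0, 3 * n + 1 - 2 * t, 3 * n - 6 * t, 6 * n + 2 - 4 * t, 4 * t + 2]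
    else if i % 2 = 1 then ![0, 2 * i + 3, i - 3 * n + 1, 2, -P i]
    else ![0, 2 * i - 1, i - 3 * n - 3, -2, P i]
  have hP0 : P 0 = 4 * n + 3 := rfl
  have hP1 : ∀ i, 0 < i → i < 2 * t → P i = 4 * n + 6 + 2 * i := by
    intro i h1 h2
    simp only [P]
    split_ifs <;> omega
  have hP2 : ∀ i, 2 * t < i → i < 3 * t + 1 → P i = 4 * (i - (2 * t + 1)) + 1 := by
    intro i h1 h2
    simp only [P]
    split_ifs <;> omega
  have hP3 : ∀ i, 3 * t + 1 ≤ i → i < 4 * t + 2 → P i = 4 * (i - (2 * t + 1)) + 4 := by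
    intro i h1 h2
    simp only [P]
    split_ifs <;> omega
  have hP4 : P (4 * t + 2) = 4 * n + 5 := by
    simp only [P]
    split_ifs <;> first | omega | contradiction
  have hx1 : ∀ i, i < 2 * t → x i = (![0, 2 * i + 2, i - 3 * n, 1, -P i] : Fin 5 → ℤ) := by
    intro i h1
    simp only [x]
    rw [if_pos h1]
  have hx2 : x (2 * t) = (![0, 3 * n + 1 - 2 * t, 3 * n - 6 * t, 6 * n + 2 - 4 * t, 4 * t + 2] : Fin 5 → ℤ) := by
    simp only [x]
    rw [if_neg (by omega), if_pos trivial]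
  have hx3 : ∀ i, 2 * t < i → i % 2 = 1 → x i = (![0, 2 * i + 3, i - 3 * n + 1, 2, -P i] : Fin 5 → ℤ) := by
    intro i h1 h2
    simp only [x]
    rw [if_neg (by omega), if_neg (by omega), if_pos h2]
  have hx4 : ∀ i, 2 * t < i → i % 2 = 0 → x i = (![0, 2 * i - 1, i - 3 * n - 3, -2, P i] : Fin 5 → ℤ) := by
    intro i h1 h2
    simp only [x]
    rw [if_neg (by omega), if_neg (by omega), if_neg (by omega)]
  clear_value x P
  have key : ∀ i < n, Function.Injective (x i) ∧
      (∃ lo : ℤ, ∀ a, lo ≤ x i a ∧ x i a < lo + (5 * (2 * n + 1) : ℕ)) ∧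
      (Function.Injective fun j => x i j + x i (j + 1)) ∧
      ∃ lo : ℤ, ∀ a, lo ≤ x i a + x i (a + 1) ∧
        x i a + x i (a + 1) < lo + (5 * (2 * n + 1) : ℕ) := by
    intro i hi
    rcases lt_trichotomy i (2 * t) with hlt | heq | hgt
    · have hp : 4 * n + 3 ≤ P i ∧ P i ≤ 5 * n + 1 := by
        rcases Nat.eq_zero_or_pos i with rfl | h0
        · omega
        · have := hP1 i h0 hlt
          omega
      rw [hx1 i hlt]
      refine ⟨injective_of_forall_lt_ne ?_, ⟨-5 * n - 2, ?_⟩, injective_of_forall_lt_ne ?_, ⟨-5 * n - 2, ?_⟩⟩ <;>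
      simp [Fin.forall_fin_succ] <;> and_intros <;> omega
    · rw [heq, hx2]
      -- All entries of the exceptional cycle are nonnegative, so the window starts at 0 instead of
      -- being centred.
      refine ⟨injective_of_forall_lt_ne ?_, ⟨0, ?_⟩, injective_of_forall_lt_ne ?_, ⟨0, ?_⟩⟩ <;>
      simp [Fin.forall_fin_succ] <;> and_intros <;> omega
    · have hp : P i = 4 * (i - (2 * t + 1)) + 1 ∧ i < 3 * t + 1 ∨
          P i = 4 * (i - (2 * t + 1)) + 4 ∧ 3 * t + 1 ≤ i ∧ i < 4 * t + 2 ∨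
          P i = 4 * n + 5 ∧ i = 4 * t + 2 := by
        by_cases h1 : i < 3 * t + 1
        · exact Or.inl ⟨hP2 i hgt h1, h1⟩
        by_cases h2 : i < 4 * t + 2
        · exact Or.inr (Or.inl ⟨hP3 i (by omega) h2, by omega, h2⟩)
        · obtain rfl : i = 4 * t + 2 := by omega
          exact Or.inr (Or.inr ⟨hP4, rfl⟩)
      clear hP0 hP1 hP2 hP3 hP4
      obtain ⟨l, rfl⟩ : ∃ l, i = 2 * t + 1 + l := ⟨i - (2 * t + 1), by omega⟩
      rw [Nat.add_sub_cancel_left] at hp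
      rcases Nat.mod_two_eq_zero_or_one (2 * t + 1 + l) with hpar | hpar
      · rw [hx4 _ hgt hpar]
        clear hx1 hx2 hx3 hx4
        refine ⟨injective_of_forall_lt_ne ?_, ⟨-5 * n - 2, ?_⟩, injective_of_forall_lt_ne ?_, ⟨-5 * n - 2, ?_⟩⟩ <;>
        simp [Fin.forall_fin_succ] <;>
        rcases hp with hp | hp | hp <;> and_intros <;> omega
      · rw [hx3 _ hgt hpar]
        clear hx1 hx2 hx3 hx4
        refine ⟨injective_of_forall_lt_ne ?_, ⟨-5 * n - 2, ?_⟩, injective_of_forall_lt_ne ?_, ⟨-5 * n - 2, ?_⟩⟩ <;>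
        simp [Fin.forall_fin_succ] <;>
        rcases hp with hp | hp | hp <;> and_intros <;> omega
  refine exists_orthogonal_of_base_cycles n 5 (by norm_num) x (fun i hi => (key i hi).1)
    (fun i hi => (key i hi).2.1) (fun i hi => (key i hi).2.2.1) (fun i hi => (key i hi).2.2.2) ?_
  intro d hd h2
  have hd0 := h2 0
  have hd1 := h2 1
  have hd2 := h2 2
  clear key h2
  have hS : ∀ i, i < 2 * t → d = P i → ∃ i < n, ∃ j, x i (j + 1) - x i j = d ∨
      x i j - x i (j + 1) = d := by
    intro i hi h
    refine ⟨i, by omega, 4, Or.inl ?_⟩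
    rw [hx1 i hi]
    simp
    omega
  have hS' : ∀ i, i < 2 * t → d = P i + 1 → ∃ i < n, ∃ j, x i (j + 1) - x i j = d ∨
      x i j - x i (j + 1) = d := by
    intro i hi h
    refine ⟨i, by omega, 3, Or.inr ?_⟩
    rw [hx1 i hi]
    simp
    omega
  have hB : ∀ i, 2 * t < i → i < n → d = P i → ∃ i < n, ∃ j, x i (j + 1) - x i j = d ∨
      x i j - x i (j + 1) = d := by
    intro i hi hi' h
    rcases Nat.mod_two_eq_zero_or_one i with hpar | hpar
    · refine ⟨i, hi', 4, Or.inr ?_⟩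
      rw [hx4 i hi hpar]
      simp
      omega
    · refine ⟨i, hi', 4, Or.inl ?_⟩
      rw [hx3 i hi hpar]
      simp
      omega
  have hB' : ∀ i, 2 * t < i → i < n → d = P i + 2 → ∃ i < n, ∃ j, x i (j + 1) - x i j = d ∨
      x i j - x i (j + 1) = d := by
    intro i hi hi' h
    rcases Nat.mod_two_eq_zero_or_one i with hpar | hpar
    · refine ⟨i, hi', 3, Or.inl ?_⟩
      rw [hx4 i hi hpar]
      simp
      omega
    · refine ⟨i, hi', 3, Or.inr ?_⟩
      rw [hx3 i hi hpar]
      simp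
      omega
  by_cases c1 : d ≤ 4 * t
  · by_cases hpar : d % 2 = 0
    · obtain ⟨i, hi⟩ : ∃ i, d = 2 * i + 2 := ⟨d / 2 - 1, by omega⟩
      refine ⟨i, by omega, 0, Or.inl ?_⟩
      rw [hx1 i (by omega)]
      simp
      omega
    · by_cases hmod : d % 4 = 1
      · have hp := hP2 (2 * t + 1 + (d - 1) / 4) (by omega) (by omega)
        exact hB (2 * t + 1 + (d - 1) / 4) (by omega) (by omega) (by rw [hp]; omega)
      · have hp := hP2 (2 * t + 1 + (d - 3) / 4) (by omega) (by omega)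
        exact hB' (2 * t + 1 + (d - 3) / 4) (by omega) (by omega) (by rw [hp]; omega)
  by_cases c2 : d = 4 * t + 1
  · refine ⟨2 * t, by omega, 1, Or.inr ?_⟩
    rw [hx2]
    simp
    omega
  by_cases c3 : d = 4 * t + 2
  · refine ⟨2 * t, by omega, 4, Or.inr ?_⟩
    rw [hx2]
    simp
    omega
  by_cases c4 : d ≤ 2 * n
  · by_cases hpar : d % 4 = 3
    · obtain ⟨i, hi⟩ : ∃ i, d + 1 = 2 * i := ⟨(d + 1) / 2, by omega⟩
      refine ⟨i, by omega, 0, Or.inl ?_⟩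
      rw [hx4 i (by omega) (by omega)]
      simp
      omega
    by_cases hpar : d % 4 = 1
    · obtain ⟨i, hi⟩ : ∃ i, d = 2 * i + 3 := ⟨(d - 3) / 2, by omega⟩
      refine ⟨i, by omega, 0, Or.inl ?_⟩
      rw [hx3 i (by omega) (by omega)]
      simp
      omega
    by_cases hmod : d % 4 = 0
    · have hp := hP3 (2 * t + 1 + (d - 4) / 4) (by omega) (by omega)
      exact hB (2 * t + 1 + (d - 4) / 4) (by omega) (by omega) (by rw [hp]; omega)
    · have hp := hP3 (2 * t + 1 + (d - 6) / 4) (by omega) (by omega)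
      exact hB' (2 * t + 1 + (d - 6) / 4) (by omega) (by omega) (by rw [hp]; omega)
  by_cases c5 : d ≤ 3 * n + 1
  · obtain ⟨i, hi⟩ : ∃ i, d + i = 3 * n + 1 := ⟨3 * n + 1 - d, by omega⟩
    rcases lt_trichotomy i (2 * t) with hlt | heq | hgt
    · refine ⟨i, by omega, 2, Or.inl ?_⟩
      rw [hx1 i hlt]
      simp
      omega
    · refine ⟨i, by omega, 0, Or.inl ?_⟩
      rw [heq, hx2]
      simp
      omega
    · refine ⟨i, by omega, 2, Or.inl ?_⟩
      rcases Nat.mod_two_eq_zero_or_one i with hpar | hpar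
      · rw [hx4 i hgt hpar]
        simp
        omega
      · rw [hx3 i hgt hpar]
        simp
        omega
  by_cases c6 : d ≤ 4 * n + 1
  · obtain ⟨i, hi⟩ : ∃ i, d = 3 * n + 2 + i := ⟨d - (3 * n + 2), by omega⟩
    rcases lt_trichotomy i (2 * t) with hlt | heq | hgt
    · refine ⟨i, by omega, 1, Or.inr ?_⟩
      rw [hx1 i hlt]
      simp
      omega
    · refine ⟨i, by omega, 2, Or.inl ?_⟩
      rw [heq, hx2]
      simp
      omega
    · refine ⟨i, by omega, 1, Or.inr ?_⟩
      rcases Nat.mod_two_eq_zero_or_one i with hpar | hpar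
      · rw [hx4 i hgt hpar]
        simp
        omega
      · rw [hx3 i hgt hpar]
        simp
        omega
  by_cases c7 : d = 4 * n + 3
  · exact hS 0 (by omega) (by omega)
  by_cases c8 : d = 4 * n + 4
  · exact hS' 0 (by omega) (by omega)
  by_cases c9 : d = 4 * n + 5
  · exact hB (4 * t + 2) (by omega) (by omega) (by omega)
  by_cases c10 : d = 4 * n + 7
  · exact hB' (4 * t + 2) (by omega) (by omega) (by omega)
  by_cases c11 : d = 4 * n + 6
  · refine ⟨2 * t, by omega, 3, Or.inr ?_⟩
    rw [hx2]
    simp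
    omega
  have hp := hP1 ((d - (4 * n + 6)) / 2) (by omega) (by omega)
  by_cases hpar : d % 2 = 0
  · exact hS ((d - (4 * n + 6)) / 2) (by omega) (by rw [hp]; omega)
  · exact hS' ((d - (4 * n + 6)) / 2) (by omega) (by rw [hp]; omega)

end CycleDecomp

theorem mainTheorem12 (n k : ℕ) (hkn : k ≤ n)
    (hcase :
      ((k = 3 ∨ k = 7 ∨ k = 9) ∧ (n % 4 = 0 ∨ n % 4 = 3)) ∨
      (k = 5 ∧ n % 4 = 3) ∨
      (k = 4 ∨ k = 8) ∨
      (k = 6 ∧ Even n)) :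
    ∃ (H : Subgroup (Equiv.Perm (Fin (2 * n + 1) × Fin k)))
      (D D' : Set (SimpleGraph.completeEquipartiteGraph (2 * n + 1) k).Subgraph),
      IsCyclic H ∧
      CycleDecomp.IsRegularCycleDecomposition k
        (SimpleGraph.completeEquipartiteGraph (2 * n + 1) k) H D ∧
      CycleDecomp.IsRegularCycleDecomposition k
        (SimpleGraph.completeEquipartiteGraph (2 * n + 1) k) H D' ∧
      CycleDecomp.Orthogonal D D' := by
  change CycleDecomp.ExistsOrthogonalCyclic n k
  rcases hcase with ⟨rfl | rfl | rfl, h⟩ | ⟨rfl, h⟩ | (rfl | rfl) | ⟨rfl, h⟩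
  · exact CycleDecomp.existsOrthogonalCyclic_three n hkn h
  · rcases h with h | h
    · exact CycleDecomp.existsOrthogonalCyclic_seven_of_mod_four_eq_zero n hkn h
    · exact CycleDecomp.existsOrthogonalCyclic_seven_of_mod_four_eq_three n hkn h
  · rcases h with h | h
    · exact CycleDecomp.existsOrthogonalCyclic_nine_of_mod_four_eq_zero n hkn h
    · exact CycleDecomp.existsOrthogonalCyclic_nine_of_mod_four_eq_three n hkn h
  · exact CycleDecomp.existsOrthogonalCyclic_five n hkn h
  · exact CycleDecomp.existsOrthogonalCyclic_four n hkn
  · exact CycleDecomp.existsOrthogonalCyclic_eight n hkn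
  · exact CycleDecomp.existsOrthogonalCyclic_six n hkn h
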